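/- Let $X$ be a locale with frame of opens $\mathcal{O}X$. A localic relation on $X$ is a sublocale $r\colon R\rightarrowtail X\times X$; its source and target maps are $s=\mathrm{pr}_1\circ r$ and $t=\mathrm{pr}_2\circ r$. It is a localic equivalence relation if it is reflexive ($\Delta\subseteq R$, with $\Delta$ the diagonal), symmetric ($R=R^{\mathrm{op}}$, where $R^{\mathrm{op}}$ is the relation with source $t$ and target $s$) and transitive ($R\circ R\subseteq R$, where $R\circ R$ is the image sublocale of $(s\pi_1,t\pi_2)\colon R\times_X^{t,s}R\to X\times X$). It has open cones if $s$ and $t$ are open, i.e. $s^{-1}$ and $t^{-1}$ have left adjoints $s_!$ and $t_!$ that satisfy Frobenius reciprocity $f_!(U\wedge f^{-1}(V))=f_!(U)\wedge V$. In that case its cones are the maps $\mathord{\uparrow}=t_!s^{-1}$ and $\mathord{\downarrow}=s_!t^{-1}$ on $\mathcal{O}X$. On the rectangles of the coproduct frame $\mathcal{O}X\otimes\mathcal{O}X=\mathcal{O}(X\times X)$ put $$A\otimes B\sim C\otimes D\iff \mathord{\uparrow}A\wedge B=\mathord{\uparrow}C\wedge D\ \text{ and }\ A\wedge\mathord{\downarrow}B=C\wedge\mathord{\downarrow}D,$$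 and let $R_{\uparrow\downarrow}\rightarrowtail X\times X$ be the sublocale whose frame is the quotient of $\mathcal{O}X\otimes\mathcal{O}X$ by the frame congruence generated by $\sim$ (equivalently, the sublocale set of all $\sim$-saturated elements). **Proposition.** Let $R$ be a localic equivalence relation with open cones on a locale $X$, let $q\colon X\to X/R$ be the coequaliser of $s$ and $t$ in the category of locales, and let $X\times_{X/R}X$ be the pullback of $q$ along itself, with its canonical map to $X\times X$. Then there is an isomorphism $R_{\uparrow\downarrow}\cong X\times_{X/R}X$ of locales over $X\times X$. Moreover $R\subseteq R_{\uparrow\downarrow}$, and under this isomorphism the inclusion $R\rightarrowtail R_{\uparrow\downarrow}$ is Kock's inclusion of $R$ into its kernel pair, that is, the map $R\to X\times_{X/R}X$ induced by $s$ and $t$. -/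

import Mathlib

open CategoryTheory CategoryTheory.Limits

universe u

namespace LocalicRel

/-! ### Sublocales generated by a binary relation on a frame -/

section Quotient

variable {L : Type u} [Order.Frame L]

/-- `s` is saturated for the binary relation `rel` on a frame. -/
def IsSaturated (rel : L → L → Prop) (s : L) : Prop :=
  ∀ a b c : L, rel a b → (a ⊓ c ≤ s ↔ b ⊓ c ≤ s)

/-- The sublocale `L/∼` of `∼`-saturated elements.  The corresponding quotient map `μ_∼` is
`(saturated rel).restrict`, which sends `x` to the least saturated element above `x`. -/
def saturated (rel : L → L → Prop) : Sublocale L where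
  carrier := {s | IsSaturated rel s}
  sInf_mem' S hS a b c hab := by
    simp only [le_sInf_iff]
    exact forall₂_congr fun s hs => hS hs a b c hab
  himp_mem' x s hs a b c hab := by
    simp only [le_himp_iff, inf_assoc]
    exact hs a b (c ⊓ x) hab

theorem restrict_eq_of_rel {rel : L → L → Prop} {a b : L} (h : rel a b) :
    (saturated rel).restrict a = (saturated rel).restrict b := by
  refine eq_of_forall_ge_iff fun s => ?_
  rw [(saturated rel).giRestrict.gc.le_iff_le, (saturated rel).giRestrict.gc.le_iff_le]
  simpa using s.2 a b ⊤ h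

theorem restrict_restrict {S T : Sublocale L} (h : S ≤ T) (x : L) :
    S.restrict (T.restrict x : L) = S.restrict x :=
  le_antisymm
    (S.giRestrict.gc.l_le
      (show T.restrict x ≤ (⟨_, h (S.restrict x).2⟩ : T) from
        T.giRestrict.gc.l_le (S.giRestrict.gc.le_u_l x)))
    (S.giRestrict.gc.monotone_l (T.giRestrict.gc.le_u_l x))

/-- The frame map `T → S` of an inclusion of sublocales `S ⊆ T`. -/
def restrictOfLE {S T : Sublocale L} (h : S ≤ T) : FrameHom T S where
  toFun t := S.restrict (t : L)
  map_inf' a b := by simp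
  map_top' := by
    have := restrict_restrict h ⊤
    rwa [map_top, map_top] at this
  map_sSup' A := by
    have hA : sSup A = T.restrict (sSup (Subtype.val '' A)) := by
      rw [T.giRestrict.gc.l_sSup, sSup_eq_iSup, iSup_image]
      exact iSup_congr fun a => iSup_congr fun _ => (T.giRestrict.l_u_eq a).symm
    rw [hA, restrict_restrict h, map_sSup, Set.image_image]

/-- The sublocale set attached to a frame map `h : L → M`: the fixed points of `h_* h`, where `h_*`
is the right adjoint of `h`. -/
def fixedSublocale {M : Type u} [Order.Frame M] (h : FrameHom L M) : Sublocale L where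
  carrier := {v | ∀ w, h w ≤ h v → w ≤ v}
  sInf_mem' S hS w hw := by
    refine le_sInf fun s hs => hS hs w (hw.trans (OrderHomClass.mono h (sInf_le hs)))
  himp_mem' x s hs w hw := by
    rw [le_himp_iff]
    refine hs _ ?_
    rw [map_inf]
    refine (inf_le_inf_right _ hw).trans ?_
    rw [← map_inf]
    exact OrderHomClass.mono h (by simp)

theorem map_restrict_of_rel {M : Type u} [Order.Frame M] (rel : L → L → Prop)
    (h : FrameHom L M) (hrel : ∀ a b, rel a b → h a = h b) (x : L) :
    h ((saturated rel).restrict x : L) = h x := by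
  refine le_antisymm ?_ (OrderHomClass.mono h ((saturated rel).giRestrict.gc.le_u_l x))
  let t : L := sSup {w | h w ≤ h x}
  have ht : h t ≤ h x := by
    rw [map_sSup]
    exact sSup_le (by rintro _ ⟨w, hw, rfl⟩; exact hw)
  have hle : ∀ w, w ≤ t ↔ h w ≤ h x := fun w =>
    ⟨fun hw => (OrderHomClass.mono h hw).trans ht, fun hw => le_sSup hw⟩
  have hts : t ∈ saturated rel := by
    intro a b c hab
    rw [hle, hle, map_inf, map_inf, hrel a b hab]
  have : ((saturated rel).restrict x) ≤ (⟨t, hts⟩ : saturated rel) := by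
    rw [(saturated rel).giRestrict.gc.le_iff_le]
    exact (hle x).2 le_rfl
  exact (OrderHomClass.mono h (show ((saturated rel).restrict x : L) ≤ t from this)).trans ht

/-- A frame map that equalises `rel` factors through the quotient by `rel`. -/
def saturatedDesc {M : Type u} [Order.Frame M] (rel : L → L → Prop) (h : FrameHom L M)
    (hrel : ∀ a b, rel a b → h a = h b) : FrameHom (saturated rel) M where
  toFun s := h s
  map_inf' a b := by simp
  map_top' := by
    have := map_restrict_of_rel rel h hrel ⊤
    rw [map_top, map_top] at this
    exact this
  map_sSup' S := by
    have hS : sSup S = (saturated rel).restrict (sSup (Subtype.val '' S)) := by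
      rw [(saturated rel).giRestrict.gc.l_sSup, sSup_eq_iSup, iSup_image]
      refine iSup_congr fun a => iSup_congr fun _ => ?_
      exact ((saturated rel).giRestrict.l_u_eq a).symm
    rw [hS, map_restrict_of_rel rel h hrel, map_sSup, Set.image_image]

@[simp] theorem saturatedDesc_restrict {M : Type u} [Order.Frame M] (rel : L → L → Prop)
    (h : FrameHom L M) (hrel : ∀ a b, rel a b → h a = h b) (x : L) :
    saturatedDesc rel h hrel ((saturated rel).restrict x) = h x :=
  map_restrict_of_rel rel h hrel x

end Quotient

/-! ### Coproducts of frames -/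

section Coproduct

theorem mem_of_le_of_le {L M : Type u} [Order.Frame L] [Order.Frame M] {D : LowerSet (L × M)}
    {a a' : L} {b b' : M} (h : (a, b) ∈ D) (ha : a' ≤ a) (hb : b' ≤ b) : (a', b') ∈ D :=
  D.lower (show (a', b') ≤ (a, b) from ⟨ha, hb⟩) h

variable (L M : Type u) [Order.Frame L] [Order.Frame M]

/-- The underlying sublocale set of the frame coproduct: lower sets `D` of `L × M` such that
`D` is closed under joins in each coordinate separately (in particular, under empty joins). -/
def coprodIdeals : Sublocale (LowerSet (L × M)) where
  carrier := {D |
    (∀ (s : Set L) (y : M), (∀ x ∈ s, (x, y) ∈ D) → (sSup s, y) ∈ D) ∧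
    (∀ (x : L) (t : Set M), (∀ y ∈ t, (x, y) ∈ D) → (x, sSup t) ∈ D)}
  sInf_mem' S hS := by
    simp only [Set.mem_ofPred_eq, LowerSet.mem_sInf_iff]
    exact ⟨fun s y h D hD => (hS hD).1 s y fun x hx => h x hx D hD,
      fun x t h D hD => (hS hD).2 x t fun y hy => h y hy D hD⟩
  himp_mem' A D hD := by
    have key : ∀ p : L × M, p ∈ A ⇨ D ↔ ∀ q ≤ p, q ∈ A → q ∈ D := by
      intro p
      rw [← LowerSet.Iic_le, le_himp_iff]
      exact ⟨fun h q hq hA => h ⟨hq, hA⟩, fun h q hq => h q hq.1 hq.2⟩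
    simp only [Set.mem_ofPred_eq, key]
    refine ⟨fun s y h ⟨a, b⟩ hq hA => ?_, fun x t h ⟨a, b⟩ hq hA => ?_⟩
    · obtain ⟨ha, hb⟩ := hq
      have : a = sSup ((fun x => a ⊓ x) '' s) := by
        rw [sSup_image, ← inf_sSup_eq]
        exact (inf_eq_left.2 ha).symm
      rw [this]
      refine hD.1 _ _ ?_
      rintro _ ⟨x, hx, rfl⟩
      exact h x hx _ ⟨inf_le_right, hb⟩ (mem_of_le_of_le hA inf_le_left le_rfl)
    · obtain ⟨ha, hb⟩ := hq
      have : b = sSup ((fun y => b ⊓ y) '' t) := by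
        rw [sSup_image, ← inf_sSup_eq]
        exact (inf_eq_left.2 hb).symm
      rw [this]
      refine hD.2 _ _ ?_
      rintro _ ⟨y, hy, rfl⟩
      exact h y hy _ ⟨ha, inf_le_right⟩ (mem_of_le_of_le hA le_rfl inf_le_left)

/-- The coproduct `L ⊗ M` of frames. -/
abbrev FrameCoprod : Type u := coprodIdeals L M

variable {L M}

/-- The basic rectangle `x ⊗ y`: the least element of `L ⊗ M` that contains the pair `(x, y)`. -/
def rect (x : L) (y : M) : FrameCoprod L M := (coprodIdeals L M).restrict (LowerSet.Iic (x, y))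

theorem rect_le_iff {x : L} {y : M} {D : FrameCoprod L M} :
    rect x y ≤ D ↔ (x, y) ∈ (D : LowerSet (L × M)) := by
  rw [rect, (coprodIdeals L M).giRestrict.gc.le_iff_le, LowerSet.Iic_le]

theorem rect_inf_rect (x x' : L) (y y' : M) :
    rect x y ⊓ rect x' y' = rect (x ⊓ x') (y ⊓ y') := by
  rw [rect, rect, rect, ← map_inf, ← LowerSet.Iic_inf]
  rfl

theorem rect_top_top : rect (⊤ : L) (⊤ : M) = ⊤ :=
  top_le_iff.1 fun _ _ => rect_le_iff.1 le_rfl |> fun h =>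
    (rect (⊤ : L) (⊤ : M)).1.lower ⟨le_top, le_top⟩ h

theorem rect_sSup_left (s : Set L) (y : M) : rect (sSup s) y = ⨆ x ∈ s, rect x y := by
  refine eq_of_forall_ge_iff fun D => ?_
  simp only [iSup_le_iff, rect_le_iff]
  exact ⟨fun h x hx => mem_of_le_of_le h (le_sSup hx) le_rfl, D.2.1 s y⟩

theorem rect_sSup_right (x : L) (t : Set M) : rect x (sSup t) = ⨆ y ∈ t, rect x y := by
  refine eq_of_forall_ge_iff fun D => ?_
  simp only [iSup_le_iff, rect_le_iff]
  exact ⟨fun h y hy => mem_of_le_of_le h le_rfl (le_sSup hy), D.2.2 x t⟩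

theorem eq_iSup_rect (D : FrameCoprod L M) :
    D = ⨆ p ∈ (D : LowerSet (L × M)), rect p.1 p.2 := by
  refine le_antisymm (fun p hp => ?_) (iSup₂_le fun p hp => rect_le_iff.2 hp)
  exact rect_le_iff.1 (le_iSup₂_of_le (f := fun (p : L × M) (_ : p ∈ D.1) => rect p.1 p.2)
    p hp le_rfl)

variable (L M) in
/-- The coproduct injection `x ↦ x ⊗ ⊤`. -/
def inlHom : FrameHom L (FrameCoprod L M) where
  toFun x := rect x ⊤
  map_inf' x x' := by rw [rect_inf_rect, inf_idem]
  map_top' := rect_top_top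
  map_sSup' s := by rw [rect_sSup_left, sSup_image]

variable (L M) in
/-- The coproduct injection `y ↦ ⊤ ⊗ y`. -/
def inrHom : FrameHom M (FrameCoprod L M) where
  toFun y := rect ⊤ y
  map_inf' y y' := by rw [rect_inf_rect, inf_idem]
  map_top' := rect_top_top
  map_sSup' s := by rw [rect_sSup_right, sSup_image]

theorem rect_eq (x : L) (y : M) : rect x y = inlHom L M x ⊓ inrHom L M y := by
  change _ = rect x ⊤ ⊓ rect ⊤ y
  rw [rect_inf_rect, inf_top_eq, top_inf_eq]

variable {N : Type u} [Order.Frame N]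

/-- The upper adjoint of the copairing `[h, k] : L ⊗ M → N`. -/
def copairAdj (h : FrameHom L N) (k : FrameHom M N) (n : N) : FrameCoprod L M :=
  ⟨⟨{p | h p.1 ⊓ k p.2 ≤ n}, fun _ _ hpq hp =>
      (inf_le_inf (OrderHomClass.mono h hpq.1) (OrderHomClass.mono k hpq.2)).trans hp⟩,
    fun s y hs => by
      change h (sSup s) ⊓ k y ≤ n
      rw [map_sSup, sSup_inf_eq, iSup₂_le_iff]
      rintro _ ⟨x, hx, rfl⟩
      exact hs x hx,
    fun x t ht => by
      change h x ⊓ k (sSup t) ≤ n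
      rw [map_sSup, inf_sSup_eq, iSup₂_le_iff]
      rintro _ ⟨y, hy, rfl⟩
      exact ht y hy⟩

/-- The copairing `[h, k] : L ⊗ M → N`. -/
def copair (h : FrameHom L N) (k : FrameHom M N) : FrameHom (FrameCoprod L M) N :=
  have gc : GaloisConnection
      (fun D : FrameCoprod L M => ⨆ p ∈ (D : LowerSet (L × M)), h p.1 ⊓ k p.2)
      (copairAdj h k) := fun D n => by
    simp only [iSup_le_iff]
    rfl
  { toFun := fun D => ⨆ p ∈ (D : LowerSet (L × M)), h p.1 ⊓ k p.2
    map_inf' := fun D E => by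
      refine le_antisymm (le_inf (gc.monotone_l inf_le_left) (gc.monotone_l inf_le_right)) ?_
      simp only [iSup_inf_eq, inf_iSup_eq, iSup_le_iff]
      intro p hp q hq
      refine le_iSup₂_of_le (p ⊓ q)
        ⟨D.1.lower inf_le_right hq, E.1.lower inf_le_left hp⟩ ?_
      rw [inf_comm (h q.1 ⊓ k q.2), Prod.fst_inf, Prod.snd_inf, map_inf, map_inf, inf_inf_inf_comm]
    map_top' := top_le_iff.1 (le_iSup₂_of_le (⊤, ⊤) trivial (by simp))
    map_sSup' := fun S => by
      rw [gc.l_sSup, sSup_image] }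

@[simp] theorem copair_rect (h : FrameHom L N) (k : FrameHom M N) (x : L) (y : M) :
    copair h k (rect x y) = h x ⊓ k y := by
  refine eq_of_forall_ge_iff fun n => ?_
  refine Iff.trans (b := rect x y ≤ copairAdj h k n) ?_ rect_le_iff
  change (⨆ p ∈ (rect x y : LowerSet (L × M)), h p.1 ⊓ k p.2) ≤ n ↔ _
  simp only [iSup_le_iff]
  rfl

theorem hom_ext {f g : FrameHom (FrameCoprod L M) N}
    (h1 : ∀ x, f (inlHom L M x) = g (inlHom L M x))
    (h2 : ∀ y, f (inrHom L M y) = g (inrHom L M y)) : f = g := by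
  ext D
  rw [eq_iSup_rect D]
  simp only [map_iSup, rect_eq, map_inf, h1, h2]

end Coproduct

/-! ### Limits and colimits of locales -/

section Category

/-- The frame map `f⁻¹ : 𝒪 Y → 𝒪 X` of a locale map `f : X → Y`. -/
def preimage {X Y : Locale.{u}} (f : X ⟶ Y) : FrameHom Y X :=
  (Quiver.Hom.unop (V := Frm.{u}) f).hom

/-- The locale map with a given frame map. -/
def mkHom {X Y : Locale.{u}} (h : FrameHom Y X) : X ⟶ Y :=
  Quiver.Hom.op (V := Frm.{u}) (Frm.ofHom h)

@[simp] theorem preimage_mkHom {X Y : Locale.{u}} (h : FrameHom Y X) :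
    preimage (mkHom h) = h := rfl

@[simp] theorem preimage_id (X : Locale.{u}) : preimage (𝟙 X) = FrameHom.id X := rfl

@[simp] theorem preimage_comp {X Y Z : Locale.{u}} (f : X ⟶ Y) (g : Y ⟶ Z) :
    preimage (f ≫ g) = (preimage f).comp (preimage g) := rfl

theorem preimage_comp_apply {X Y Z : Locale.{u}} (f : X ⟶ Y) (g : Y ⟶ Z) (z : Z) :
    preimage (f ≫ g) z = preimage f (preimage g z) := rfl

theorem locale_hom_ext {X Y : Locale.{u}} {f g : X ⟶ Y}
    (h : ∀ y, preimage f y = preimage g y) : f = g :=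
  Quiver.Hom.unop_inj (Frm.hom_ext (FrameHom.ext h))

/-- The product of two locales: its frame of opens is the frame coproduct. -/
def prodLoc (X Y : Locale.{u}) : Locale.{u} := Locale.of (FrameCoprod X Y)

/-- The first projection; `pr₁⁻¹(U) = U ⊗ ⊤`. -/
def pr₁ (X Y : Locale.{u}) : prodLoc X Y ⟶ X := mkHom (inlHom X Y)

/-- The second projection; `pr₂⁻¹(V) = ⊤ ⊗ V`. -/
def pr₂ (X Y : Locale.{u}) : prodLoc X Y ⟶ Y := mkHom (inrHom X Y)

/-- The pairing `(f, g) : Z → X × Y`. -/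
def pair {X Y Z : Locale.{u}} (f : Z ⟶ X) (g : Z ⟶ Y) : Z ⟶ prodLoc X Y :=
  mkHom (Y := prodLoc X Y) (copair (preimage f) (preimage g))

theorem preimage_pair_rect {X Y Z : Locale.{u}} (f : Z ⟶ X) (g : Z ⟶ Y) (U : X) (V : Y) :
    preimage (pair f g) (rect U V : FrameCoprod X Y) = preimage f U ⊓ preimage g V :=
  copair_rect _ _ U V

@[simp] theorem pair_pr₁ {X Y Z : Locale.{u}} (f : Z ⟶ X) (g : Z ⟶ Y) :
    pair f g ≫ pr₁ X Y = f :=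
  locale_hom_ext fun U => (preimage_pair_rect f g U ⊤).trans (by simp)

@[simp] theorem pair_pr₂ {X Y Z : Locale.{u}} (f : Z ⟶ X) (g : Z ⟶ Y) :
    pair f g ≫ pr₂ X Y = g :=
  locale_hom_ext fun V => (preimage_pair_rect f g ⊤ V).trans (by simp)

theorem prod_hom_ext {X Y Z : Locale.{u}} {f g : Z ⟶ prodLoc X Y}
    (h1 : f ≫ pr₁ X Y = g ≫ pr₁ X Y) (h2 : f ≫ pr₂ X Y = g ≫ pr₂ X Y) : f = g :=
  locale_hom_ext fun D => DFunLike.congr_fun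
    (hom_ext (f := preimage f) (g := preimage g)
      (fun x => DFunLike.congr_fun (congrArg preimage h1) x)
      (fun y => DFunLike.congr_fun (congrArg preimage h2) y)) D

/-- `X × Y` is the categorical product. -/
def prodLocIsLimit (X Y : Locale.{u}) : IsLimit (BinaryFan.mk (pr₁ X Y) (pr₂ X Y)) :=
  BinaryFan.isLimitMk (fun s => pair s.fst s.snd) (fun _ => pair_pr₁ _ _)
    (fun _ => pair_pr₂ _ _) (fun _ _ h1 h2 => prod_hom_ext
      (h1.trans (pair_pr₁ _ _).symm) (h2.trans (pair_pr₂ _ _).symm))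

instance : HasBinaryProducts Locale.{u} :=
  have (X Y : Locale.{u}) : HasLimit (Limits.pair X Y) := ⟨⟨⟨_, prodLocIsLimit X Y⟩⟩⟩
  hasBinaryProducts_of_hasLimit_pair _

/-- A sublocale of `X`, as a locale in its own right. -/
def subLoc {X : Locale.{u}} (S : Sublocale X) : Locale.{u} := Locale.of S

/-- The inclusion map of a sublocale. -/
def incl {X : Locale.{u}} (S : Sublocale X) : subLoc S ⟶ X := mkHom (X := subLoc S) S.restrict

theorem preimage_incl_surjective {X : Locale.{u}} (S : Sublocale X) :
    Function.Surjective (preimage (incl S)) := S.giRestrict.l_surjective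

instance {X Y : Locale.{u}} (f g : X ⟶ Y) : HasLimit (parallelPair f g) := by
  let rel : X → X → Prop := fun a b => ∃ v : Y, a = preimage f v ∧ b = preimage g v
  have w : incl (saturated rel) ≫ f = incl (saturated rel) ≫ g :=
    locale_hom_ext fun v => restrict_eq_of_rel ⟨v, rfl, rfl⟩
  have hs (s : Fork f g) : ∀ a b, rel a b → preimage s.ι a = preimage s.ι b := by
    rintro _ _ ⟨v, rfl, rfl⟩
    exact DFunLike.congr_fun (congrArg preimage s.condition) v
  exact ⟨⟨⟨Fork.ofι _ w, Fork.IsLimit.mk _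
    (fun s => mkHom (Y := subLoc (saturated rel)) (saturatedDesc rel (preimage s.ι) (hs s)))
    (fun s => locale_hom_ext fun x => saturatedDesc_restrict rel _ (hs s) x)
    (fun s m hm => locale_hom_ext fun x => by
      obtain ⟨x, rfl⟩ := preimage_incl_surjective _ x
      refine (DFunLike.congr_fun (congrArg preimage hm) x).trans ?_
      exact (saturatedDesc_restrict rel _ (hs s) x).symm)⟩⟩⟩

instance : HasEqualizers Locale.{u} := hasEqualizers_of_hasLimit_parallelPair _

instance : HasPullbacks Locale.{u} := hasPullbacks_of_hasBinaryProducts_of_hasEqualizers _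

end Category

section Subframe

variable {L M : Type u} [Order.Frame L] [Order.Frame M]

/-- The subframe `{x | f x = g x}` on which two frame maps agree. -/
structure EqFrame (f g : FrameHom L M) : Type u where
  /-- The underlying element. -/
  val : L
  eq : f val = g val

namespace EqFrame

variable (f g : FrameHom L M)

theorem val_injective : Function.Injective (val : EqFrame f g → L)
  | ⟨_, _⟩, ⟨_, _⟩, rfl => rfl

instance : PartialOrder (EqFrame f g) := PartialOrder.lift val (val_injective f g)

instance : SemilatticeInf (EqFrame f g) where
  inf a b := ⟨a.1 ⊓ b.1, by rw [map_inf, map_inf, a.2, b.2]⟩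
  inf_le_left a b := show a.1 ⊓ b.1 ≤ a.1 from inf_le_left
  inf_le_right a b := show a.1 ⊓ b.1 ≤ b.1 from inf_le_right
  le_inf a b c h1 h2 := show a.1 ≤ b.1 ⊓ c.1 from le_inf h1 h2

instance : SupSet (EqFrame f g) where
  sSup S := ⟨sSup (val '' S), by
    rw [map_sSup, map_sSup, Set.image_image, Set.image_image]
    exact congrArg sSup (Set.image_congr fun a _ => a.2)⟩

theorem isLUB_sSup' (S : Set (EqFrame f g)) : IsLUB S (sSup S) :=
  ⟨fun a ha => show a.1 ≤ sSup (val '' S) from le_sSup ⟨a, ha, rfl⟩,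
    fun b hb => show sSup (val '' S) ≤ b.1 from
      sSup_le (by rintro _ ⟨a, ha, rfl⟩; exact hb ha)⟩

instance : CompleteLattice (EqFrame f g) where
  __ := (inferInstance : SemilatticeInf (EqFrame f g))
  __ := completeLatticeOfSup (EqFrame f g) (isLUB_sSup' f g)

instance : Order.Frame (EqFrame f g) := .ofMinimalAxioms
  { inf_sSup_le_iSup_inf := fun a S => by
      change a.1 ⊓ sSup (val '' S) ≤ (⨆ b ∈ S, a ⊓ b : EqFrame f g).1
      rw [inf_sSup_eq, iSup₂_le_iff]
      rintro _ ⟨b, hb, rfl⟩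
      exact le_iSup₂ (f := fun (b : EqFrame f g) (_ : b ∈ S) => a ⊓ b) b hb }

/-- The inclusion of the subframe. -/
def valHom : FrameHom (EqFrame f g) L where
  toFun := val
  map_inf' _ _ := rfl
  map_top' := top_le_iff.1 (show (⊤ : L) ≤ (⊤ : EqFrame f g).1 from
    le_top (a := (⟨⊤, by simp⟩ : EqFrame f g)))
  map_sSup' _ := rfl

/-- The universal property of the subframe. -/
def lift {N : Type u} [Order.Frame N] (h : FrameHom N L) (w : ∀ x, f (h x) = g (h x)) :
    FrameHom N (EqFrame f g) where
  toFun x := ⟨h x, w x⟩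
  map_inf' a b := val_injective f g (map_inf h a b)
  map_top' := val_injective f g ((map_top h).trans (map_top (valHom f g)).symm)
  map_sSup' S := val_injective f g ((map_sSup h S).trans (by
    change _ = sSup (val '' _)
    rw [Set.image_image]))

end EqFrame

instance {X Y : Locale.{u}} (f g : X ⟶ Y) : HasColimit (parallelPair f g) := by
  have w : f ≫ mkHom (Y := Locale.of (EqFrame (preimage f) (preimage g))) (EqFrame.valHom _ _) =
      g ≫ mkHom (Y := Locale.of (EqFrame (preimage f) (preimage g))) (EqFrame.valHom _ _) :=
    locale_hom_ext fun v => v.eq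
  exact ⟨⟨⟨Cofork.ofπ _ w, Cofork.IsColimit.mk _
    (fun s => mkHom (X := Locale.of (EqFrame (preimage f) (preimage g)))
      (EqFrame.lift _ _ (preimage s.π) (DFunLike.congr_fun (congrArg preimage s.condition))))
    (fun _ => rfl)
    (fun s m hm => locale_hom_ext fun x =>
      EqFrame.val_injective _ _ (DFunLike.congr_fun (congrArg preimage hm) x))⟩⟩⟩

instance : HasCoequalizers Locale.{u} := hasCoequalizers_of_hasColimit_parallelPair _

end Subframe

/-! ### Localic relations -/

section Relations

/-- The image sublocale of a locale map, as a sublocale set: the fixed points of `f_* f⁻¹`. -/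
def image {X Y : Locale.{u}} (f : X ⟶ Y) : Sublocale Y := fixedSublocale (preimage f)

/-- The locale map `S → T` underlying an inclusion `S ⊆ T` of sublocales. -/
def inclOfLE {X : Locale.{u}} {S T : Sublocale X} (h : S ≤ T) : subLoc S ⟶ subLoc T :=
  mkHom (X := subLoc S) (Y := subLoc T) (restrictOfLE h)

theorem inclOfLE_incl {X : Locale.{u}} {S T : Sublocale X} (h : S ≤ T) :
    inclOfLE h ≫ incl T = incl S :=
  locale_hom_ext fun x => restrict_restrict h x

/-- A localic relation on `X` is a sublocale of `X × X`. -/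
abbrev LocalicRelation (X : Locale.{u}) : Type u := Sublocale (prodLoc X X)

variable {X : Locale.{u}}

/-- The source map `pr₁ ∘ r` of a relation `r : R ↣ X × X`. -/
def source (R : LocalicRelation X) : subLoc R ⟶ X := incl R ≫ pr₁ X X

/-- The target map `pr₂ ∘ r` of a relation `r : R ↣ X × X`. -/
def target (R : LocalicRelation X) : subLoc R ⟶ X := incl R ≫ pr₂ X X

/-- The diagonal relation. -/
def diagonal (X : Locale.{u}) : LocalicRelation X := image (pair (𝟙 X) (𝟙 X))

/-- The opposite relation, with source and target interchanged. -/
def opposite (R : LocalicRelation X) : LocalicRelation X := image (pair (target R) (source R))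

/-- The composite `R ∘ Q` (first `R`, then `Q`): the image in `X × X` of the pullback of the target
map of `R` along the source map of `Q`. -/
noncomputable def composite (R Q : LocalicRelation X) : LocalicRelation X :=
  image (pair (pullback.fst (target R) (source Q) ≫ source R)
    (pullback.snd (target R) (source Q) ≫ target Q))

/-- Localic equivalence relations: reflexive, symmetric and transitive. -/
structure IsEquivalence (R : LocalicRelation X) : Prop where
  refl : diagonal X ≤ R
  symm : R = opposite R
  trans : composite R R ≤ R

/-- Open maps of locales: `f⁻¹` has a left adjoint that satisfies Frobenius reciprocity. -/
def IsOpenMap {X Y : Locale.{u}} (f : X ⟶ Y) : Prop :=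
  ∃ l : X → Y, GaloisConnection l (preimage f) ∧
    ∀ (U : X) (V : Y), l (U ⊓ preimage f V) = l U ⊓ V

/-- The map `f_!`, given by the formula for the left adjoint of `f⁻¹`. -/
def shriek {X Y : Locale.{u}} (f : X ⟶ Y) (U : X) : Y := sInf {V | U ≤ preimage f V}

theorem shriek_eq {X Y : Locale.{u}} {f : X ⟶ Y} {l : X → Y}
    (h : GaloisConnection l (preimage f)) : shriek f = l :=
  funext fun U => le_antisymm (sInf_le (h.le_u_l U)) (le_sInf fun _ hV => h.l_le hV)

theorem IsOpenMap.gc {X Y : Locale.{u}} {f : X ⟶ Y} (hf : IsOpenMap f) :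
    GaloisConnection (shriek f) (preimage f) := by
  obtain ⟨l, hl, -⟩ := hf
  rwa [shriek_eq hl]

theorem IsOpenMap.frobenius {X Y : Locale.{u}} {f : X ⟶ Y} (hf : IsOpenMap f) (U : X) (V : Y) :
    shriek f (U ⊓ preimage f V) = shriek f U ⊓ V := by
  obtain ⟨l, hl, h⟩ := hf
  rw [shriek_eq hl, h]

/-- A relation has open cones if its source and target maps are open. -/
structure HasOpenCones (R : LocalicRelation X) : Prop where
  source : IsOpenMap (source R)
  target : IsOpenMap (target R)

/-- The up cone `t_! s⁻¹`. -/
def upCone (R : LocalicRelation X) (U : X) : X := shriek (target R) (preimage (source R) U)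

/-- The down cone `s_! t⁻¹`. -/
def downCone (R : LocalicRelation X) (U : X) : X := shriek (source R) (preimage (target R) U)

/-- The relation `∼` on rectangles of `𝒪 X ⊗ 𝒪 X` induced by cones `up`, `down`:
`A ⊗ B ∼ C ⊗ D` iff `up A ∧ B = up C ∧ D` and `A ∧ down B = C ∧ down D`. -/
def coneRel (up down : X → X) (u v : FrameCoprod X X) : Prop :=
  ∃ A B C D : X, u = rect A B ∧ v = rect C D ∧
    up A ⊓ B = up C ⊓ D ∧ A ⊓ down B = C ⊓ down D

/-- The localic relation induced by a pair of cones: the sublocale `(𝒪 X ⊗ 𝒪 X)/∼`. -/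
def inducedRelation (up down : X → X) : LocalicRelation X :=
  saturated (L := FrameCoprod X X) (coneRel up down)

/-- The relation `R_{↑↓}` induced by the cones of `R`. -/
def upDown (R : LocalicRelation X) : LocalicRelation X :=
  inducedRelation (upCone R) (downCone R)

/-- The quotient map `X → X/R`: the coequaliser of the source and target maps of `R`. -/
noncomputable def quotientMap (R : LocalicRelation X) :
    X ⟶ coequalizer (source R) (target R) := coequalizer.π (source R) (target R)

/-- The kernel pair `X ×_Q X` of a locale map `q : X → Q`. -/
noncomputable abbrev kernelPair {Q : Locale.{u}} (q : X ⟶ Q) : Locale.{u} := pullback q q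

/-- The canonical map `X ×_Q X → X × X`. -/
noncomputable def kernelPairMap {Q : Locale.{u}} (q : X ⟶ Q) : kernelPair q ⟶ prodLoc X X :=
  pair (pullback.fst q q) (pullback.snd q q)

/-- Kock's inclusion of `R` into its kernel pair `X ×_{X/R} X`: the map induced by the source and
target maps of `R`. -/
noncomputable def kockInclusion (R : LocalicRelation X) :
    subLoc R ⟶ kernelPair (quotientMap R) :=
  pullback.lift (source R) (target R) (coequalizer.condition (source R) (target R))

theorem kockInclusion_kernelPairMap (R : LocalicRelation X) :
    kockInclusion R ≫ kernelPairMap (quotientMap R) = incl R := by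
  refine prod_hom_ext ?_ ?_
  · rw [kernelPairMap, Category.assoc, pair_pr₁]
    exact pullback.lift_fst _ _ _
  · rw [kernelPairMap, Category.assoc, pair_pr₂]
    exact pullback.lift_snd _ _ _

end Relations

end LocalicRel

/-! Both locales are quotients of the frame `𝒪X ⊗ 𝒪X`, and each quotient satisfies the relations
that define the other. Opens of `X/R` are the invariant opens `V`, those with `s⁻¹V = t⁻¹V`, so the
kernel pair imposes `V ⊗ ⊤ = ⊤ ⊗ V` for invariant `V`. Such a `V` is its own cone, hence `V ⊗ ⊤ ∼ ⊤
⊗ V`, and `R_{↑↓}` maps to the kernel pair.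

Conversely, `↑A` is invariant and contains `A`; by symmetry `↓ = ↑`. In the kernel pair this forces
`A ⊗ B = (A ∧ ↓B) ⊗ (↑A ∧ B)`, which depends only on the two opens compared by `∼`. So the kernel
pair maps to `R_{↑↓}`. Both locales are monic over `X × X`, so the two maps are mutually inverse.

The real work is the invariance of `↑A` (`preimage_source_upCone`). It needs transitivity together
with the Beck–Chevalley inequality `preimage_shriek_le_of_pullback`, which rests on Frobenius
reciprocity. -/

namespace LocalicRel

/-! ### Images and inclusions of sublocales -/

section Images

/-- If the image of `f` is contained in `S`, then `f⁻¹` factors through the quotient by `S`. -/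
theorem preimage_le_of_image_le {X Y : Locale.{u}} {f : X ⟶ Y} {S : Sublocale Y}
    (hf : image f ≤ S) {x y : Y} (h : preimage (incl S) x ≤ preimage (incl S) y) :
    preimage f x ≤ preimage f y := by
  -- This is `f_* f⁻¹ y`; being a fixed point of `f_* f⁻¹`, it lies in the image and so in `S`.
  let v : Y := sSup {w | preimage f w ≤ preimage f y}
  have hv : preimage f v ≤ preimage f y := by
    rw [map_sSup]
    exact sSup_le (by rintro _ ⟨w, hw, rfl⟩; exact hw)
  have hvS : v ∈ S := hf (show v ∈ image f from fun w hw => le_sSup (hw.trans hv))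
  have hy : S.restrict y ≤ ⟨v, hvS⟩ :=
    (S.giRestrict.gc.le_iff_le).2 (le_sSup (a := y) le_rfl)
  have hx : x ≤ v := (S.giRestrict.gc.le_iff_le (b := ⟨v, hvS⟩)).1 (le_trans h hy)
  exact (OrderHomClass.mono (preimage f) hx).trans hv

/-- For `s ∈ S`, whether `x ≤ s` depends only on the class of `x` in `S`, and passing to classes
preserves meets. -/
theorem le_saturated_of_rel {L : Type u} [Order.Frame L] {rel : L → L → Prop} {S : Sublocale L}
    (h : ∀ a b, rel a b → S.restrict a = S.restrict b) : S ≤ saturated rel := by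
  intro s hs a b c hab
  have key (x : L) : x ≤ s ↔ S.restrict x ≤ ⟨s, hs⟩ :=
    (S.giRestrict.gc.le_iff_le (b := ⟨s, hs⟩)).symm
  rw [key, key, map_inf, map_inf, h a b hab]

/-- The hypothesis compares `U ⊗ ⊤` with `⊤ ⊗ V` on `R`, and `(f, g)` factors through `R`.
Reflexivity, symmetry and transitivity are turned into inequalities of opens in this way. -/
theorem preimage_pair_le_of_image_le {X Z : Locale.{u}} {f g : Z ⟶ X} {R : LocalicRelation X}
    (hf : image (pair f g) ≤ R) {U V : X}
    (h : preimage (source R) U ≤ preimage (target R) V) : preimage f U ≤ preimage g V := by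
  have := preimage_le_of_image_le hf (x := rect U ⊤) (y := rect ⊤ V) h
  rw [preimage_pair_rect, preimage_pair_rect] at this
  simpa using this

end Images

/-! ### Beck–Chevalley inequality for open maps -/

section BeckChevalley

variable {A B Z : Locale.{u}}

/-- The relation on `𝒪 A ⊗ 𝒪 B` that presents the pullback of `f` and `g`. -/
def pullbackRel (f : A ⟶ Z) (g : B ⟶ Z) (u v : FrameCoprod A B) : Prop :=
  ∃ V : Z, u = rect (preimage f V) ⊤ ∧ v = rect ⊤ (preimage g V)

/-- The ideal of those `(a, b)` with `g⁻¹ f_! a ∧ b ≤ c`, for an open map `f`. -/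
def openPullbackIdeal {f : A ⟶ Z} (hf : IsOpenMap f) (g : B ⟶ Z) (c : B) : FrameCoprod A B :=
  ⟨⟨{p | preimage g (shriek f p.1) ⊓ p.2 ≤ c}, fun _ _ hpq hp =>
      (inf_le_inf (OrderHomClass.mono _ (hf.gc.monotone_l hpq.1)) hpq.2).trans hp⟩,
    fun s y hs => by
      change preimage g (shriek f (sSup s)) ⊓ y ≤ c
      rw [hf.gc.l_sSup]
      simp only [map_iSup, iSup_inf_eq, iSup_le_iff]
      exact hs,
    fun x t ht => by
      change preimage g (shriek f x) ⊓ sSup t ≤ c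
      rw [inf_sSup_eq, iSup₂_le_iff]
      exact ht⟩

theorem rect_le_openPullbackIdeal {f : A ⟶ Z} (hf : IsOpenMap f) (g : B ⟶ Z) {a : A} {b c : B} :
    rect a b ≤ openPullbackIdeal hf g c ↔ preimage g (shriek f a) ⊓ b ≤ c :=
  rect_le_iff

/-- It is enough to test rectangles. There Frobenius gives `f_!(a ∧ f⁻¹V) = f_! a ∧ V`, and applying
`g⁻¹` moves the factor `V` to the second coordinate as `g⁻¹V`. -/
theorem openPullbackIdeal_mem_saturated {f : A ⟶ Z} (hf : IsOpenMap f) (g : B ⟶ Z) (c : B) :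
    openPullbackIdeal hf g c ∈ saturated (pullbackRel f g) := by
  rintro _ _ D ⟨V, rfl, rfl⟩
  rw [eq_iSup_rect D]
  simp only [inf_iSup_eq, iSup_le_iff, rect_inf_rect, rect_le_openPullbackIdeal, top_inf_eq]
  refine forall₂_congr fun p _ => ?_
  rw [inf_comm (preimage f V), hf.frobenius, map_inf, inf_assoc]

/-- The inequality `g⁻¹ f_! ≤ π₂_! π₁⁻¹` for the pullback of an open map `f` along `g`. -/
theorem preimage_shriek_le_of_pullback {f : A ⟶ Z} (hf : IsOpenMap f) (g : B ⟶ Z) {a : A} {c : B}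
    (h : preimage (pullback.fst f g) a ≤ preimage (pullback.snd f g) c) :
    preimage g (shriek f a) ≤ c := by
  -- Only the fact that `S` is a cone over `f` and `g` is used: the induced map to the pullback
  -- transports `h` to `S`, where elements are explicit ideals.
  let S : Sublocale (prodLoc A B) := saturated (L := FrameCoprod A B) (pullbackRel f g)
  have w : (incl S ≫ pr₁ A B) ≫ f = (incl S ≫ pr₂ A B) ≫ g :=
    locale_hom_ext fun V => restrict_eq_of_rel (rel := pullbackRel f g) ⟨V, rfl, rfl⟩
  have h' := OrderHomClass.mono (preimage (pullback.lift _ _ w)) h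
  rw [← preimage_comp_apply, ← preimage_comp_apply, pullback.lift_fst, pullback.lift_snd] at h'
  have hc : S.restrict (rect ⊤ c) ≤ ⟨_, openPullbackIdeal_mem_saturated hf g c⟩ :=
    (S.giRestrict.gc.le_iff_le).2 ((rect_le_openPullbackIdeal hf g).2 inf_le_right)
  -- As the ideal is saturated, an inequality into it in the quotient `S` already holds in `𝒪A ⊗
  -- 𝒪B`.
  have ha : rect a ⊤ ≤ openPullbackIdeal hf g c :=
    (S.giRestrict.gc.le_iff_le (b := ⟨_, openPullbackIdeal_mem_saturated hf g c⟩)).1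
      (le_trans h' hc)
  simpa using (rect_le_openPullbackIdeal hf g).1 ha

end BeckChevalley

/-! ### Kernel pairs and invariant opens -/

section KernelPair

variable {X : Locale.{u}}

theorem kernelPairMap_pr₁ {Q : Locale.{u}} (q : X ⟶ Q) :
    kernelPairMap q ≫ pr₁ X X = pullback.fst q q := pair_pr₁ _ _

theorem kernelPairMap_pr₂ {Q : Locale.{u}} (q : X ⟶ Q) :
    kernelPairMap q ≫ pr₂ X X = pullback.snd q q := pair_pr₂ _ _

theorem preimage_kernelPairMap_rect {Q : Locale.{u}} (q : X ⟶ Q) (A B : X) :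
    preimage (kernelPairMap q) (rect A B : FrameCoprod X X) =
      preimage (pullback.fst q q) A ⊓ preimage (pullback.snd q q) B :=
  preimage_pair_rect _ _ A B

instance {Q : Locale.{u}} (q : X ⟶ Q) : Mono (kernelPairMap q) where
  right_cancellation g h w := by
    refine pullback.hom_ext ?_ ?_
    · rw [← kernelPairMap_pr₁, ← Category.assoc, w, Category.assoc]
    · rw [← kernelPairMap_pr₂, ← Category.assoc, w, Category.assoc]

/-- The opens of `X/R` are the opens of `X` on which the source and target maps agree. -/
theorem exists_preimage_quotientMap {R : LocalicRelation X} {V : X}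
    (hV : preimage (source R) V = preimage (target R) V) :
    ∃ W, preimage (quotientMap R) W = V := by
  -- The subframe of invariant opens gives a cofork; the map it induces out of the coequaliser pulls
  -- `V`, seen as an element of `F`, back to the required `W`.
  let F := EqFrame (preimage (source R)) (preimage (target R))
  let p : X ⟶ Locale.of F := mkHom (Y := Locale.of F) (EqFrame.valHom _ _)
  have w : source R ≫ p = target R ≫ p := locale_hom_ext fun v => EqFrame.eq v
  let v : F := ⟨V, hV⟩
  exact ⟨preimage (coequalizer.desc p w) v,
    DFunLike.congr_fun (congrArg preimage (coequalizer.π_desc p w)) v⟩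

theorem preimage_source_quotientMap (R : LocalicRelation X)
    (W : (coequalizer (source R) (target R) : Locale.{u})) :
    preimage (source R) (preimage (quotientMap R) W) =
      preimage (target R) (preimage (quotientMap R) W) :=
  DFunLike.congr_fun (congrArg preimage (coequalizer.condition (source R) (target R))) W

/-- An invariant open descends to `X/R`, and the two projections agree after composition with the
quotient map. -/
theorem preimage_fst_eq_snd {R : LocalicRelation X} {V : X}
    (hV : preimage (source R) V = preimage (target R) V) :
    preimage (pullback.fst (quotientMap R) (quotientMap R)) V =
      preimage (pullback.snd (quotientMap R) (quotientMap R)) V := by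
  obtain ⟨W, rfl⟩ := exists_preimage_quotientMap hV
  exact DFunLike.congr_fun (congrArg preimage
    (pullback.condition (f := quotientMap R) (g := quotientMap R))) W

end KernelPair

/-! ### Invariance of cones and the comparison maps -/

section Cones

variable {X : Locale.{u}} {R : LocalicRelation X}

theorem IsEquivalence.preimage_target_le_source (hR : IsEquivalence R) {U V : X}
    (h : preimage (source R) U ≤ preimage (target R) V) :
    preimage (target R) U ≤ preimage (source R) V :=
  preimage_pair_le_of_image_le hR.symm.ge h

theorem IsEquivalence.preimage_source_le_target (hR : IsEquivalence R) {U V : X}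
    (h : preimage (target R) U ≤ preimage (source R) V) :
    preimage (source R) U ≤ preimage (target R) V := by
  have h' : preimage (incl R) (rect ⊤ U : FrameCoprod X X) ≤
      preimage (incl R) (rect V ⊤ : FrameCoprod X X) := h
  have := preimage_le_of_image_le hR.symm.ge h'
  rw [preimage_pair_rect, preimage_pair_rect] at this
  simpa using this

theorem IsEquivalence.le_of_source_le_target (hR : IsEquivalence R) {U V : X}
    (h : preimage (source R) U ≤ preimage (target R) V) : U ≤ V :=
  preimage_pair_le_of_image_le hR.refl h

/-- Both cones are infima, of `{V | t⁻¹U ≤ s⁻¹V}` and `{V | s⁻¹U ≤ t⁻¹V}`; symmetry makes these sets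
equal. -/
theorem IsEquivalence.downCone_eq_upCone (hR : IsEquivalence R) (U : X) :
    downCone R U = upCone R U :=
  congrArg sInf (Set.ext fun _ =>
    ⟨hR.preimage_source_le_target, hR.preimage_target_le_source⟩)

theorem HasOpenCones.source_le_target_upCone (ho : HasOpenCones R) (U : X) :
    preimage (LocalicRel.source R) U ≤ preimage (LocalicRel.target R) (upCone R U) :=
  ho.target.gc.le_u_l _

theorem le_upCone (hR : IsEquivalence R) (ho : HasOpenCones R) (U : X) : U ≤ upCone R U :=
  hR.le_of_source_le_target (ho.source_le_target_upCone U)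

/-- Up cones are invariant under the relation. -/
theorem preimage_source_upCone (hR : IsEquivalence R) (ho : HasOpenCones R) (U : X) :
    preimage (source R) (upCone R U) = preimage (target R) (upCone R U) := by
  -- Transitivity applied to `s⁻¹U ≤ t⁻¹↑U` gives `π₁⁻¹s⁻¹U ≤ π₂⁻¹t⁻¹↑U`. Beck–Chevalley for `t`
  -- along `s` turns this into `s⁻¹t_!s⁻¹U ≤ t⁻¹↑U`, whose left side is `s⁻¹↑U`.
  have h : preimage (source R) (upCone R U) ≤ preimage (target R) (upCone R U) :=
    preimage_shriek_le_of_pullback ho.target (source R)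
      (preimage_pair_le_of_image_le hR.trans (ho.source_le_target_upCone U))
  exact h.antisymm (hR.preimage_target_le_source h)

theorem upCone_eq_self (hR : IsEquivalence R) (ho : HasOpenCones R) {V : X}
    (hV : preimage (source R) V = preimage (target R) V) : upCone R V = V :=
  (ho.target.gc.l_le hV.le).antisymm (le_upCone hR ho V)

/-- Modulo the kernel pair, the rectangle `A ⊗ B` equals `(A ∧ ↓B) ⊗ (↑A ∧ B)`. -/
theorem preimage_kernelPairMap_rect_cones (hR : IsEquivalence R) (ho : HasOpenCones R) (A B : X) :
    preimage (kernelPairMap (quotientMap R)) (rect A B : FrameCoprod X X) =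
      preimage (kernelPairMap (quotientMap R))
        (rect (A ⊓ downCone R B) (upCone R A ⊓ B) : FrameCoprod X X) := by
  rw [hR.downCone_eq_upCone, preimage_kernelPairMap_rect, preimage_kernelPairMap_rect, map_inf,
    map_inf]
  have hA := OrderHomClass.mono (preimage (pullback.fst (quotientMap R) (quotientMap R)))
    (le_upCone hR ho A)
  have hB := OrderHomClass.mono (preimage (pullback.snd (quotientMap R) (quotientMap R)))
    (le_upCone hR ho B)
  -- Invariance of the cones moves `↑A` to the second projection and `↑B` to the first, so the extra
  -- factors are absorbed.
  rw [preimage_fst_eq_snd (preimage_source_upCone hR ho A)] at hA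
  rw [← preimage_fst_eq_snd (preimage_source_upCone hR ho B)] at hB
  exact le_antisymm
    (le_inf (le_inf inf_le_left (inf_le_right.trans hB)) (le_inf (inf_le_left.trans hA) inf_le_right))
    (inf_le_inf inf_le_left inf_le_right)

theorem preimage_kernelPairMap_eq_of_coneRel (hR : IsEquivalence R) (ho : HasOpenCones R)
    (u v : FrameCoprod X X) (huv : coneRel (upCone R) (downCone R) u v) :
    preimage (kernelPairMap (quotientMap R)) u = preimage (kernelPairMap (quotientMap R)) v := by
  obtain ⟨A, B, C, D, rfl, rfl, h1, h2⟩ := huv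
  rw [preimage_kernelPairMap_rect_cones hR ho, h1, h2, ← preimage_kernelPairMap_rect_cones hR ho]

/-- Kock's map factors the inclusion of `R` through the kernel pair, where related rectangles
already coincide. -/
theorem le_upDown (hR : IsEquivalence R) (ho : HasOpenCones R) : R ≤ upDown R :=
  le_saturated_of_rel fun a b hab => by
    change preimage (incl R) a = preimage (incl R) b
    rw [← kockInclusion_kernelPairMap, preimage_comp_apply, preimage_comp_apply,
      preimage_kernelPairMap_eq_of_coneRel hR ho a b hab]

theorem incl_upDown_condition (hR : IsEquivalence R) (ho : HasOpenCones R) :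
    (incl (upDown R) ≫ pr₁ X X) ≫ quotientMap R = (incl (upDown R) ≫ pr₂ X X) ≫ quotientMap R := by
  refine locale_hom_ext fun W => restrict_eq_of_rel (rel := coneRel (upCone R) (downCone R)) ?_
  have hV := preimage_source_quotientMap R W
  -- With `V = q⁻¹W`, this is `V ⊗ ⊤ ∼ ⊤ ⊗ V`; both conditions reduce to `V = V` since `↑V = V` and
  -- `↑⊤ = ⊤`.
  refine ⟨preimage (quotientMap R) W, ⊤, ⊤, preimage (quotientMap R) W, rfl, rfl, ?_, ?_⟩ <;>
  simp only [hR.downCone_eq_upCone, upCone_eq_self hR ho hV,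
    top_le_iff.1 (le_upCone hR ho ⊤), inf_top_eq, top_inf_eq]

/-- The comparison map `R_{↑↓} → X ×_{X/R} X`. -/
noncomputable def upDownToKernelPair (hR : IsEquivalence R) (ho : HasOpenCones R) :
    subLoc (upDown R) ⟶ kernelPair (quotientMap R) :=
  pullback.lift _ _ (incl_upDown_condition hR ho)

theorem upDownToKernelPair_kernelPairMap (hR : IsEquivalence R) (ho : HasOpenCones R) :
    upDownToKernelPair hR ho ≫ kernelPairMap (quotientMap R) = incl (upDown R) := by
  refine prod_hom_ext ?_ ?_
  · rw [Category.assoc, kernelPairMap_pr₁]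
    exact pullback.lift_fst _ _ _
  · rw [Category.assoc, kernelPairMap_pr₂]
    exact pullback.lift_snd _ _ _

/-- The inverse comparison map `X ×_{X/R} X → R_{↑↓}`. -/
noncomputable def kernelPairToUpDown (hR : IsEquivalence R) (ho : HasOpenCones R) :
    kernelPair (quotientMap R) ⟶ subLoc (upDown R) :=
  mkHom (Y := subLoc (upDown R)) (saturatedDesc _ (preimage (kernelPairMap (quotientMap R)))
    (preimage_kernelPairMap_eq_of_coneRel hR ho))

theorem kernelPairToUpDown_incl (hR : IsEquivalence R) (ho : HasOpenCones R) :
    kernelPairToUpDown hR ho ≫ incl (upDown R) = kernelPairMap (quotientMap R) :=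
  locale_hom_ext fun x => saturatedDesc_restrict (coneRel (upCone R) (downCone R)) _
    (preimage_kernelPairMap_eq_of_coneRel hR ho) x

theorem incl_cancel {Y Z : Locale.{u}} {S : Sublocale Y} {f g : Z ⟶ subLoc S}
    (h : f ≫ incl S = g ≫ incl S) : f = g :=
  locale_hom_ext fun x => by
    obtain ⟨x, rfl⟩ := preimage_incl_surjective S x
    exact DFunLike.congr_fun (congrArg preimage h) x

/-- `R_{↑↓}` is the kernel pair of the quotient map of `R`. -/
noncomputable def upDownIsoKernelPair (hR : IsEquivalence R) (ho : HasOpenCones R) :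
    subLoc (upDown R) ≅ kernelPair (quotientMap R) where
  hom := upDownToKernelPair hR ho
  inv := kernelPairToUpDown hR ho
  hom_inv_id := incl_cancel <| by
    rw [Category.assoc, kernelPairToUpDown_incl, upDownToKernelPair_kernelPairMap,
      Category.id_comp]
  inv_hom_id := by
    rw [← cancel_mono (kernelPairMap (quotientMap R)), Category.assoc,
      upDownToKernelPair_kernelPairMap, kernelPairToUpDown_incl, Category.id_comp]

end Cones

end LocalicRel

theorem mainTheorem8 (X : Locale.{u}) (R : LocalicRel.LocalicRelation X)
    (hR : LocalicRel.IsEquivalence R) (hopen : LocalicRel.HasOpenCones R) :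
    ∃ e : LocalicRel.subLoc (LocalicRel.upDown R) ≅
        LocalicRel.kernelPair (LocalicRel.quotientMap R),
      e.hom ≫ LocalicRel.kernelPairMap (LocalicRel.quotientMap R) =
        LocalicRel.incl (LocalicRel.upDown R) ∧
      ∃ h : R ≤ LocalicRel.upDown R,
        LocalicRel.inclOfLE h ≫ e.hom = LocalicRel.kockInclusion R := by
  have he : (LocalicRel.upDownIsoKernelPair hR hopen).hom ≫
      LocalicRel.kernelPairMap (LocalicRel.quotientMap R) =
        LocalicRel.incl (LocalicRel.upDown R) :=
    LocalicRel.upDownToKernelPair_kernelPairMap hR hopen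
  refine ⟨LocalicRel.upDownIsoKernelPair hR hopen, he, LocalicRel.le_upDown hR hopen, ?_⟩
  -- Both maps lie over `X × X`, and the kernel pair is monic there.
  rw [← cancel_mono (LocalicRel.kernelPairMap (LocalicRel.quotientMap R)), Category.assoc, he,
    LocalicRel.inclOfLE_incl, LocalicRel.kockInclusion_kernelPairMap]
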